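/- Let $D$ be the formal derivative with respect to the context-free grammar $$x\to xy,\quad y\to zu,\quad z\to zw,\quad w\to xv,\quad u\to xyz^{-1}v,\quad v\to x^{-1}zwu,$$ that is, the $\mathbb{C}$-linear derivation on Laurent polynomials in $x,y,z,w,u,v$ (fractional exponents being allowed) which sends each variable to the right-hand side of its rule, and let $$\mathrm{Gen}(f,t)=\sum_{n=0}^\infty D^n(f)\,\frac{t^n}{n!}.$$ For $a,\zeta\in\mathbb{C}$ let $$D_a(\zeta)=2^{a/2}\sqrt{\pi}\,e^{-\zeta^2/4}\left(\frac{1}{\Gamma\left(\frac{1-a}{2}\right)}\,{}_1F_1\left(-\frac a2;\frac12;\frac{\zeta^2}{2}\right)-\frac{\sqrt2\,\zeta}{\Gamma\left(-\frac a2\right)}\,{}_1F_1\left(\frac{1-a}{2};\frac32;\frac{\zeta^2}{2}\right)\right)$$ be the parabolic cylinder function, where ${}_1F_1(a;b;\zeta)=\sum_{n\ge0}\frac{(a)_n}{(b)_n}\frac{\zeta^n}{n!}$ and $1/\Gamma=0$ at the poles of $\Gamma$. Let $x,y,z,w,u,v$ take complex values with $x\ne0$, $z\ne0$ and $xv\neq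 zu$. Let $\delta$ and $\hat\delta$ be any square roots of $xv-zu$ and of $zu-xv$, respectively, and set $$p=D_{\frac{zu-yw}{\delta^2}}\left(\frac{w-y}{\delta}\right),\quad q=D_{\frac{xv-yw}{\hat\delta^2}}\left(\frac{y-w}{\hat\delta}\right),\quad r=D_{\frac{xv-yw}{\delta^2}}\left(\frac{w-y}{\delta}\right),\quad s=D_{\frac{zu-yw}{\hat\delta^2}}\left(\frac{y-w}{\hat\delta}\right).$$ Then $pq(w-y)+\hat\delta ps-\delta qr\ne0$, and for every $t\in\mathbb{C}$ the series $\mathrm{Gen}(x^{-1/2}z^{-1/2},t)$, evaluated at these values (powers of $x$ and $z$ with fractional exponents being principal values), converges absolutely and $$\mathrm{Gen}\left(x^{-1/2}z^{-1/2},t\right)=\frac{x^{-1/2}z^{-1/2}}{pq(w-y)+(\hat\delta ps-\delta qr)}\left((\hat\delta s-qy)\,D_{\frac{zu-yw}{\delta^2}}\left(\delta t+\frac{w-y}{\delta}\right)+(pw-\delta r)\,D_{\frac{xv-yw}{\hat\delta^2}}\left(\hat\delta t+\frac{y-w}{\hat\delta}\right)\right).$$ -/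

import Mathlib

open scoped Nat

noncomputable section

/-- The algebra of formal Laurent polynomials over `ℂ` in the variables `V`, with monomials
`∏ i, i ^ (e i)`. Exponents are rational numbers, so that monomials such as `x^(-1/2) z^(-1/2)`
are available along with the usual integral ones. -/
abbrev LaurentPoly (V : Type) : Type := AddMonoidAlgebra ℂ (V → ℚ)

namespace LaurentPoly

/-- The monomial `∏ i, i ^ (e i)`. -/
def mono {V : Type} (e : V → ℚ) : LaurentPoly V := AddMonoidAlgebra.single e 1

/-- A power `i ^ a` of the variable `i`. -/
def pow {V : Type} [DecidableEq V] (i : V) (a : ℚ) : LaurentPoly V := mono (Pi.single i a)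

/-- The value of a Laurent polynomial at a point of `ℂ ^ V`, fractional powers being taken with
their principal values. -/
def eval {V : Type} [Fintype V] (P : V → ℂ) (f : LaurentPoly V) : ℂ :=
  f.coeff.sum fun e c => c * ∏ i, P i ^ (e i : ℂ)

end LaurentPoly

/-- A context-free grammar: it assigns a Laurent polynomial to every variable. -/
abbrev Grammar (V : Type) : Type := V → LaurentPoly V

namespace Grammar

open LaurentPoly

variable {V : Type} [Fintype V] [DecidableEq V]

/-- `∑ i, e i * i^(-1) * m * G i`, the derivative of the monomial `m` with exponents `e`. -/
def derivMono (G : Grammar V) (e : V → ℚ) : LaurentPoly V :=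
  ∑ i, ((e i : ℚ) : ℂ) • (mono (e - Pi.single i 1) * G i)

/-- The linear extension of `derivMono`. -/
def derivLin (G : Grammar V) : LaurentPoly V →ₗ[ℂ] LaurentPoly V :=
  Finsupp.lsum ℂ (fun e => LinearMap.toSpanSingleton ℂ (LaurentPoly V) (derivMono G e)) ∘ₗ
    (AddMonoidAlgebra.coeffLinearEquiv ℂ).toLinearMap

theorem derivLin_single (G : Grammar V) (e : V → ℚ) (c : ℂ) :
    derivLin G (AddMonoidAlgebra.single e c) = c • derivMono G e := by
  simp [derivLin, AddMonoidAlgebra.coeff_single]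

theorem derivMono_zero (G : Grammar V) : derivMono G 0 = 0 := by
  simp [derivMono]

theorem derivMono_add (G : Grammar V) (e f : V → ℚ) :
    derivMono G (e + f) = mono e * derivMono G f + mono f * derivMono G e := by
  have h1 : ∀ i : V, mono (e + f - Pi.single i 1) = mono e * mono (f - Pi.single i (1 : ℚ)) := by
    intro i
    simp [mono, AddMonoidAlgebra.single_mul_single, add_sub_assoc]
  have h2 : ∀ i : V, mono (e + f - Pi.single i 1) = mono f * mono (e - Pi.single i (1 : ℚ)) := by
    intro i
    rw [add_comm e f]
    simp [mono, AddMonoidAlgebra.single_mul_single, add_sub_assoc]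
  simp only [derivMono, Finset.mul_sum, ← Finset.sum_add_distrib]
  refine Finset.sum_congr rfl fun i _ => ?_
  rw [mul_smul_comm, mul_smul_comm, ← mul_assoc, ← mul_assoc, ← h1, ← h2, ← add_smul,
    Pi.add_apply, Rat.cast_add, add_comm]

theorem derivLin_leibniz (G : Grammar V) (a b : LaurentPoly V) :
    derivLin G (a * b) = a • derivLin G b + b • derivLin G a := by
  induction a using AddMonoidAlgebra.induction_linear with
  | zero => simp
  | add a a' ha ha' =>
    rw [add_mul, map_add, map_add, ha, ha', smul_add, add_smul]
    abel
  | single e c =>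
    induction b using AddMonoidAlgebra.induction_linear with
    | zero => simp
    | add b b' hb hb' =>
      rw [mul_add, map_add, map_add, hb, hb', smul_add, add_smul]
      abel
    | single f d =>
      have hs : ∀ (g : V → ℚ) (k : ℂ),
          (AddMonoidAlgebra.single g k : LaurentPoly V) = k • mono g := by
        intro g k
        simp [mono]
      rw [AddMonoidAlgebra.single_mul_single, derivLin_single, derivLin_single, derivLin_single,
        derivMono_add, hs e c, hs f d]
      simp only [smul_eq_mul, smul_mul_assoc, mul_smul_comm, smul_smul, smul_add]
      rw [mul_comm d c]

/-- The formal derivative with respect to the grammar `G`: the derivation of the algebra of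
Laurent polynomials that sends every variable `i` to `G i`. -/
def formalDeriv (G : Grammar V) : Derivation ℂ (LaurentPoly V) (LaurentPoly V) where
  toLinearMap := derivLin G
  map_one_eq_zero' := by
    rw [AddMonoidAlgebra.one_def]
    exact (derivLin_single G 0 1).trans (by rw [derivMono_zero, smul_zero])
  leibniz' := derivLin_leibniz G

theorem formalDeriv_var (G : Grammar V) (i : V) : formalDeriv G (pow i 1) = G i := by
  have h : formalDeriv G (pow i 1) = (1 : ℂ) • derivMono G (Pi.single i 1) :=
    derivLin_single G _ 1
  rw [h, one_smul, derivMono, Finset.sum_eq_single i]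
  · simp [mono, ← AddMonoidAlgebra.one_def]
  · intro j _ hj
    simp [hj]
  · simp

/-- The generating function `Gen(f, t) = ∑ D^n(f) t^n / n!`, a formal power series in `t` over
the algebra of Laurent polynomials. -/
def gen (G : Grammar V) (f : LaurentPoly V) : PowerSeries (LaurentPoly V) :=
  PowerSeries.mk fun n => ((n ! : ℂ)⁻¹) • (formalDeriv G)^[n] f

end Grammar

/-- The six variables of the peak grammar. -/
inductive PeakVar : Type
  | x | y | z | w | u | v
  deriving DecidableEq

instance : Fintype PeakVar where
  elems := {.x, .y, .z, .w, .u, .v}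
  complete i := by cases i <;> simp

/-- The grammar `x → xy`, `y → zu`, `z → zw`, `w → xv`, `u → x y z⁻¹ v`, `v → x⁻¹ z w u`. -/
def peakGrammar : Grammar PeakVar
  | .x => .pow .x 1 * .pow .y 1
  | .y => .pow .z 1 * .pow .u 1
  | .z => .pow .z 1 * .pow .w 1
  | .w => .pow .x 1 * .pow .v 1
  | .u => .pow .x 1 * .pow .y 1 * .pow .z (-1) * .pow .v 1
  | .v => .pow .x (-1) * .pow .z 1 * .pow .w 1 * .pow .u 1

/-- The point of `ℂ ^ PeakVar` with the given coordinates. -/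
def peakPoint (x y z w u v : ℂ) : PeakVar → ℂ
  | .x => x
  | .y => y
  | .z => z
  | .w => w
  | .u => u
  | .v => v

/-- The confluent hypergeometric function `₁F₁(a; b; z)`. -/
def hyp1F1 (a b z : ℂ) : ℂ :=
  ∑' n : ℕ, (ascPochhammer ℂ n).eval a / (ascPochhammer ℂ n).eval b * (z ^ n / (n ! : ℂ))

/-- The parabolic cylinder function `D_a(z)` of Whittaker and Watson. At the poles of `Γ` the
reciprocal `1 / Γ` is `0`, since `Complex.Gamma` takes the value `0` there. -/
def parabolicD (a z : ℂ) : ℂ :=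
  (2 : ℂ) ^ (a / 2) * ((Real.sqrt Real.pi : ℝ) : ℂ) * Complex.exp (-(z ^ 2 / 4)) *
    (1 / Complex.Gamma ((1 - a) / 2) * hyp1F1 (-(a / 2)) (1 / 2) (z ^ 2 / 2) -
      ((Real.sqrt 2 : ℝ) : ℂ) * z / Complex.Gamma (-(a / 2)) *
        hyp1F1 ((1 - a) / 2) (3 / 2) (z ^ 2 / 2))

end

/-! ### Entire functions given by power series. -/

section EntirePowerSeries

variable {c : ℕ → ℂ}

/-! Put `U = zu` and `V = xv`. The grammar gives `y' = U`, `w' = V` and `U' = V' = wU + yV`, so `V -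
U` and `U - yw` are constants of the flow and `w - y` is linear in `t`. The logarithmic derivatives
of `x` and `z` are `y` and `w`, so the generating function `H` satisfies `H'/H = -(y+w)/2`.
Differentiating once more gives `H'' = ((w-y)²/4 - (U-yw) - (V-U)/2) H`, which is Weber's equation
in `δt + (w-y)/δ`.

Two solutions are `D_a(ζ)` and `D_{-a-1}(kζ)` with `k² = -1`. They are independent by
`wronskian_parabolicD_ne_zero`, and the denominator is `δ` times their Wronskian. The recurrence
`deriv_parabolicD` expresses the initial slopes through `r` and `s`, which fixes the coefficients.

The argument runs backwards: the closed form is an entire `H` with the right equation and initial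
data, and `y`, `w`, `U`, `V` along the flow are recovered from `H'/H` near `0`. Hence its Taylor
coefficients are the evaluated iterates of the formal derivative (`iteratedDeriv_eq_eval_peakOp`,
`iterate_formalDeriv_peakBase`), and the Taylor series of an entire function converges everywhere.
-/

theorem summable_norm_mul_pow (hc : ∀ z : ℂ, Summable fun n => c n * z ^ n) (R : ℝ) :
    Summable fun n => ‖c n‖ * |R| ^ n := by
  simpa using (hc (R : ℂ)).norm

theorem differentiable_tsum_mul_pow (hc : ∀ z : ℂ, Summable fun n => c n * z ^ n) :
    Differentiable ℂ fun z : ℂ => ∑' n, c n * z ^ n := by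
  intro z
  have h := Complex.differentiableOn_tsum_of_summable_norm
    (F := fun n (z : ℂ) => c n * z ^ n) (U := Metric.ball 0 (‖z‖ + 1))
    (summable_norm_mul_pow hc (‖z‖ + 1)) (fun n => by fun_prop) Metric.isOpen_ball
    (fun n w hw => by
      rw [norm_mul, norm_pow, abs_of_nonneg (by positivity)]
      gcongr
      exact (mem_ball_zero_iff.mp hw).le)
  exact h.differentiableAt (Metric.isOpen_ball.mem_nhds (by simp))

theorem hasSum_deriv_tsum_mul_pow (hc : ∀ z : ℂ, Summable fun n => c n * z ^ n) (z : ℂ) :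
    HasSum (fun n => c n * (n * z ^ (n - 1))) (deriv (fun z : ℂ => ∑' n, c n * z ^ n) z) := by
  have h := Complex.hasSum_deriv_of_summable_norm
    (F := fun n (z : ℂ) => c n * z ^ n) (U := Metric.ball 0 (‖z‖ + 1)) (z := z)
    (summable_norm_mul_pow hc (‖z‖ + 1)) (fun n => by fun_prop) Metric.isOpen_ball
    (fun n w hw => by
      rw [norm_mul, norm_pow, abs_of_nonneg (by positivity)]
      gcongr
      exact (mem_ball_zero_iff.mp hw).le) (by simp)
  simpa using h

theorem hasSum_mul_deriv_tsum_mul_pow (hc : ∀ z : ℂ, Summable fun n => c n * z ^ n) (z : ℂ) :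
    HasSum (fun n => n * c n * z ^ n) (z * deriv (fun z : ℂ => ∑' n, c n * z ^ n) z) := by
  refine ((hasSum_deriv_tsum_mul_pow hc z).mul_left z).congr_fun ?_
  rintro (_ | n)
  · simp
  · simp only [Nat.add_sub_cancel]
    ring

theorem hasSum_succ_deriv_tsum_mul_pow (hc : ∀ z : ℂ, Summable fun n => c n * z ^ n) (z : ℂ) :
    HasSum (fun n => ((n + 1 : ℕ) * c (n + 1)) * z ^ n)
      (deriv (fun z : ℂ => ∑' n, c n * z ^ n) z) := by
  have h := (hasSum_nat_add_iff' 1).mpr (hasSum_deriv_tsum_mul_pow hc z)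
  simp only [Finset.range_one, Finset.sum_singleton, Nat.cast_zero, zero_mul, mul_zero,
    sub_zero, Nat.add_sub_cancel] at h
  exact h.congr_fun fun n => by ring

end EntirePowerSeries

/-! ### Kummer's function and its equation. -/

section Kummer

/-- The coefficients of `₁F₁(a; b; z)`. -/
noncomputable def kummerCoeff (a b : ℂ) (n : ℕ) : ℂ :=
  (ascPochhammer ℂ n).eval a / (ascPochhammer ℂ n).eval b / (n ! : ℂ)

theorem hyp1F1_eq_tsum (a b : ℂ) : hyp1F1 a b = fun z => ∑' n, kummerCoeff a b n * z ^ n := by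
  funext z
  exact tsum_congr fun n => by rw [kummerCoeff]; ring

theorem ofReal_add_natCast_ne_zero {b : ℝ} (hb : 0 < b) (n : ℕ) : (b : ℂ) + n ≠ 0 := by
  have : b + n ≠ 0 := by positivity
  exact_mod_cast this

theorem kummerCoeff_succ (a : ℂ) {b : ℝ} (hb : 0 < b) (n : ℕ) :
    (b + n) * ((n + 1 : ℕ) * kummerCoeff a b (n + 1)) = (a + n) * kummerCoeff a b n := by
  have h1 := ofReal_add_natCast_ne_zero hb n
  have h2 : ((n + 1 : ℕ) : ℂ) ≠ 0 := by exact_mod_cast n.succ_ne_zero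
  rw [kummerCoeff, kummerCoeff, ascPochhammer_succ_eval, ascPochhammer_succ_eval,
    Nat.factorial_succ, Nat.cast_mul]
  rw [mul_div_mul_comm]
  field_simp

theorem summable_kummerCoeff_mul_pow (a : ℂ) {b : ℝ} (hb : 0 < b) (z : ℂ) :
    Summable fun n => kummerCoeff a b n * z ^ n := by
  -- The maximum with `1` lets `C` absorb `‖a‖` into `C * b` and `n` into `C * n` separately.
  set C : ℝ := max (‖a‖ / b) 1
  have hC : ∀ n : ℕ, ‖a + n‖ ≤ C * ‖(b : ℂ) + n‖ := by
    intro n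
    have h1 : ‖(b : ℂ) + n‖ = b + n := by
      have : (b : ℂ) + n = ((b + n : ℝ) : ℂ) := by push_cast; rfl
      rw [this, Complex.norm_real, Real.norm_of_nonneg (by positivity)]
    have h2 : ‖a‖ ≤ C * b := (div_le_iff₀ hb).mp (le_max_left _ _)
    have h3 : (n : ℝ) ≤ C * n := le_mul_of_one_le_left (by positivity) (le_max_right _ _)
    rw [h1, mul_add]
    calc ‖a + n‖ ≤ ‖a‖ + ‖(n : ℂ)‖ := norm_add_le _ _
      _ ≤ C * b + C * n := by rw [Complex.norm_natCast]; exact add_le_add h2 h3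
  have hC0 : 0 ≤ C := le_trans zero_le_one (le_max_right _ _)
  obtain ⟨N, hN⟩ := exists_nat_ge (2 * (C * ‖z‖))
  refine summable_of_ratio_norm_eventually_le (r := 1 / 2) (by norm_num) ?_
  filter_upwards [Filter.eventually_ge_atTop N] with n hn
  have hn1 : (0 : ℝ) < ‖((n + 1 : ℕ) : ℂ)‖ := by
    rw [Complex.norm_natCast]; positivity
  have hb1 : 0 < ‖(b : ℂ) + n‖ := norm_pos_iff.mpr (ofReal_add_natCast_ne_zero hb n)
  have key := congrArg norm (kummerCoeff_succ a hb n)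
  simp only [norm_mul] at key
  have h4 : ‖((n + 1 : ℕ) : ℂ)‖ * ‖kummerCoeff a b (n + 1)‖ ≤ C * ‖kummerCoeff a b n‖ := by
    refine le_of_mul_le_mul_left ?_ hb1
    rw [key]
    calc _ ≤ (C * ‖(b : ℂ) + n‖) * ‖kummerCoeff a b n‖ := by gcongr; exact hC n
      _ = _ := by ring
  have h5 : 2 * (C * ‖z‖) ≤ ‖((n + 1 : ℕ) : ℂ)‖ := by
    rw [Complex.norm_natCast]
    push_cast
    have : (N : ℝ) ≤ n := by exact_mod_cast hn
    linarith
  rw [norm_mul, norm_mul, norm_pow, norm_pow]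
  refine le_of_mul_le_mul_left ?_ hn1
  calc _ = (‖((n + 1 : ℕ) : ℂ)‖ * ‖kummerCoeff a b (n + 1)‖) * ‖z‖ ^ (n + 1) := by ring
    _ ≤ (C * ‖kummerCoeff a b n‖) * ‖z‖ ^ (n + 1) := by gcongr
    _ = (2 * (C * ‖z‖)) * (1 / 2 * (‖kummerCoeff a b n‖ * ‖z‖ ^ n)) := by ring
    _ ≤ _ := by gcongr

theorem differentiable_hyp1F1 (a : ℂ) {b : ℝ} (hb : 0 < b) : Differentiable ℂ (hyp1F1 a b) := by
  rw [hyp1F1_eq_tsum]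
  exact differentiable_tsum_mul_pow (summable_kummerCoeff_mul_pow a hb)

/-- Kummer's differential equation. -/
theorem kummer_equation (a : ℂ) {b : ℝ} (hb : 0 < b) (z : ℂ) :
    z * deriv (deriv (hyp1F1 a b)) z = a * hyp1F1 a b z - (b - z) * deriv (hyp1F1 a b) z := by
  have hs := summable_kummerCoeff_mul_pow a hb
  have h1 := hasSum_mul_deriv_tsum_mul_pow hs z
  have h2 := hasSum_succ_deriv_tsum_mul_pow hs
  have h3 := hasSum_mul_deriv_tsum_mul_pow (fun z => (h2 z).summable) z
  have h4 : (fun z : ℂ => ∑' n, ((n + 1 : ℕ) * kummerCoeff a b (n + 1)) * z ^ n) =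
      deriv (hyp1F1 a b) := by
    funext z
    rw [hyp1F1_eq_tsum, (h2 z).tsum_eq]
  rw [h4] at h3
  have h2z := h2 z
  have h0 := (hs z).hasSum
  rw [← hyp1F1_eq_tsum] at h1 h2z
  rw [show (∑' n, kummerCoeff a b n * z ^ n) = hyp1F1 a b z by rw [hyp1F1_eq_tsum]] at h0
  -- The `n`-th coefficient of this combination is zero by the recurrence `kummerCoeff_succ`.
  have h5 := ((h3.add (h2z.mul_left (b : ℂ))).sub h1).sub (h0.mul_left a)
  have h6 := h5.unique (hasSum_zero.congr_fun fun n => by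
    linear_combination (z ^ n) * kummerCoeff_succ a hb n)
  linear_combination h6

theorem hyp1F1_zero (a b : ℂ) : hyp1F1 a b 0 = 1 := by
  rw [hyp1F1, tsum_eq_single 0 fun n hn => by simp [hn]]
  simp

end Kummer

/-! ### Uniqueness for `f'' = Q f`. -/

section SecondOrder

variable {f Q : ℂ → ℂ}

/-- Each differentiation replaces `f''` by `Q f`. At a point where `f` and `f'` vanish, all Taylor
coefficients therefore vanish. -/
theorem exists_iteratedDeriv_eq (hf : Differentiable ℂ f) (hQ : Differentiable ℂ Q)
    (h : ∀ z, deriv (deriv f) z = Q z * f z) (n : ℕ) :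
    ∃ A B : ℂ → ℂ, Differentiable ℂ A ∧ Differentiable ℂ B ∧
      iteratedDeriv n f = fun z => A z * f z + B z * deriv f z := by
  induction n with
  | zero => exact ⟨1, 0, differentiable_const 1, differentiable_const 0, by ext; simp⟩
  | succ n ih =>
    obtain ⟨A, B, hA, hB, hn⟩ := ih
    refine ⟨fun z => deriv A z + B z * Q z, fun z => A z + deriv B z,
      hA.deriv.add (hB.mul hQ), hA.add hB.deriv, ?_⟩
    funext z
    rw [iteratedDeriv_succ, hn]
    have h1 := ((hA z).hasDerivAt.mul (hf z).hasDerivAt).add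
      ((hB z).hasDerivAt.mul (hf.deriv z).hasDerivAt)
    rw [h] at h1
    refine h1.deriv.trans ?_
    ring

/-- An entire solution of `f'' = Q f` with vanishing initial values is zero. -/
theorem eq_zero_of_deriv_deriv_eq (hf : Differentiable ℂ f) (hQ : Differentiable ℂ Q)
    (h : ∀ z, deriv (deriv f) z = Q z * f z) (h0 : f 0 = 0) (h1 : deriv f 0 = 0) (z : ℂ) :
    f z = 0 := by
  refine (Complex.hasSum_taylorSeries_of_entire hf 0 z).unique (hasSum_zero.congr_fun fun n => ?_)
  obtain ⟨A, B, -, -, hn⟩ := exists_iteratedDeriv_eq hf hQ h n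
  simp [hn, h0, h1]

end SecondOrder

/-! ### Weber's equation, recurrence and Wronskian of parabolic cylinder functions. -/

section Parabolic

theorem parabolicD_and_derivs (a : ℂ) :
    ∃ D' : ℂ → ℂ, (∀ ζ, HasDerivAt (parabolicD a) (D' ζ) ζ) ∧
      (∀ ζ, HasDerivAt D' ((ζ ^ 2 / 4 - 1 / 2 - a) * parabolicD a ζ) ζ) ∧
      D' 0 = -((2 : ℂ) ^ (a / 2) * ((Real.sqrt Real.pi : ℝ) : ℂ) *
        (((Real.sqrt 2 : ℝ) : ℂ) / Complex.Gamma (-(a / 2)))) := by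
  have c1 : (((1 / 2 : ℝ) : ℝ) : ℂ) = 1 / 2 := by push_cast; rfl
  have c3 : (((3 / 2 : ℝ) : ℝ) : ℂ) = 3 / 2 := by push_cast; rfl
  have hm := differentiable_hyp1F1 (-(a / 2)) (b := 1 / 2) (by norm_num)
  have hn := differentiable_hyp1F1 ((1 - a) / 2) (b := 3 / 2) (by norm_num)
  have km := kummer_equation (-(a / 2)) (b := 1 / 2) (by norm_num)
  have kn := kummer_equation ((1 - a) / 2) (b := 3 / 2) (by norm_num)
  rw [c1] at hm km
  rw [c3] at hn kn
  have hD : parabolicD a = fun ζ => (2 : ℂ) ^ (a / 2) * ((Real.sqrt Real.pi : ℝ) : ℂ) *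
      Complex.exp (-(ζ ^ 2 / 4)) * (1 / Complex.Gamma ((1 - a) / 2) *
        hyp1F1 (-(a / 2)) (1 / 2) (ζ ^ 2 / 2) -
      ((Real.sqrt 2 : ℝ) : ℂ) * ζ / Complex.Gamma (-(a / 2)) *
        hyp1F1 ((1 - a) / 2) (3 / 2) (ζ ^ 2 / 2)) := rfl
  have hn0 := hyp1F1_zero ((1 - a) / 2) (3 / 2)
  rw [hD]
  clear hD
  -- From here only differentiability, the two Kummer equations and the value `1` at `0` of the
  -- second series matter; the Gamma factors become free constants.
  generalize hyp1F1 (-(a / 2)) (1 / 2) = m at *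
  generalize hyp1F1 ((1 - a) / 2) (3 / 2) = n at *
  generalize (2 : ℂ) ^ (a / 2) * ((Real.sqrt Real.pi : ℝ) : ℂ) = K
  generalize ((Real.sqrt 2 : ℝ) : ℂ) = t
  simp only [one_div, one_mul, div_eq_mul_inv _ (Complex.Gamma _)]
  generalize (Complex.Gamma ((1 - a) / 2))⁻¹ = α
  generalize (Complex.Gamma (-(a / 2)))⁻¹ = β
  have hsq : ∀ ζ : ℂ, HasDerivAt (fun ζ : ℂ => ζ ^ 2 / 2) ζ ζ := fun ζ => by
    simpa using ((hasDerivAt_id ζ).pow 2).div_const 2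
  have hexp : ∀ ζ : ℂ, HasDerivAt (fun ζ : ℂ => Complex.exp (-(ζ ^ 2 / 4)))
      (Complex.exp (-(ζ ^ 2 / 4)) * (-(ζ / 2))) ζ := fun ζ => by
    have h := (((hasDerivAt_id ζ).pow 2).div_const 4).neg.cexp
    refine h.congr_deriv ?_
    simp
    ring
  have comp : ∀ {g : ℂ → ℂ}, Differentiable ℂ g → ∀ ζ : ℂ,
      HasDerivAt (fun ζ => g (ζ ^ 2 / 2)) (deriv g (ζ ^ 2 / 2) * ζ) ζ := fun {g} hg ζ =>
    (hg _).hasDerivAt.comp ζ (hsq ζ)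
  refine ⟨fun ζ => K * Complex.exp (-(ζ ^ 2 / 4)) *
    (α * (deriv m (ζ ^ 2 / 2) * ζ) - t * β * (n (ζ ^ 2 / 2) + ζ * (deriv n (ζ ^ 2 / 2) * ζ)) -
      ζ / 2 * (α * m (ζ ^ 2 / 2) - t * ζ * β * n (ζ ^ 2 / 2))), fun ζ => ?_, fun ζ => ?_, ?_⟩
  · refine (((hexp ζ).const_mul K).mul (((comp hm ζ).const_mul α).sub
      ((((hasDerivAt_id ζ).const_mul t).mul_const β).mul (comp hn ζ)))).congr_deriv ?_
    simp only [id, Pi.mul_apply, Pi.sub_apply]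
    ring
  · have h1 := (comp hm ζ)
    have h2 := (comp hn ζ)
    have h3 := (comp hm.deriv ζ)
    have h4 := (comp hn.deriv ζ)
    have hi := hasDerivAt_id ζ
    refine (((hexp ζ).const_mul K).mul ((((h3.mul hi).const_mul α).sub
      ((h2.add (hi.mul (h4.mul hi))).const_mul (t * β))).sub
      ((hi.div_const 2).mul ((h1.const_mul α).sub
        (((hi.const_mul t).mul_const β).mul h2))))).congr_deriv ?_
    simp only [id, Pi.mul_apply, Pi.add_apply, Pi.sub_apply]
    linear_combination (2 * K * Complex.exp (-(ζ ^ 2 / 4)) * α) * km (ζ ^ 2 / 2) -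
      (2 * K * Complex.exp (-(ζ ^ 2 / 4)) * t * β * ζ) * kn (ζ ^ 2 / 2)
  · simp [hn0]

theorem differentiable_parabolicD (a : ℂ) : Differentiable ℂ (parabolicD a) := by
  obtain ⟨D', h, -⟩ := parabolicD_and_derivs a
  exact fun ζ => (h ζ).differentiableAt

/-- Weber's differential equation. -/
theorem deriv_deriv_parabolicD (a ζ : ℂ) :
    deriv (deriv (parabolicD a)) ζ = (ζ ^ 2 / 4 - 1 / 2 - a) * parabolicD a ζ := by
  obtain ⟨D', h, h', -⟩ := parabolicD_and_derivs a
  rw [show deriv (parabolicD a) = D' from funext fun ζ => (h ζ).deriv, (h' ζ).deriv]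

theorem hasDerivAt_parabolicD (a ζ : ℂ) :
    HasDerivAt (parabolicD a) (deriv (parabolicD a) ζ) ζ :=
  (differentiable_parabolicD a ζ).hasDerivAt

theorem hasDerivAt_deriv_parabolicD (a ζ : ℂ) :
    HasDerivAt (deriv (parabolicD a)) ((ζ ^ 2 / 4 - 1 / 2 - a) * parabolicD a ζ) ζ :=
  ((differentiable_parabolicD a).deriv ζ).hasDerivAt.congr_deriv (deriv_deriv_parabolicD a ζ)

theorem deriv_parabolicD_zero (a : ℂ) :
    deriv (parabolicD a) 0 = -((2 : ℂ) ^ (a / 2) * ((Real.sqrt Real.pi : ℝ) : ℂ) *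
        (((Real.sqrt 2 : ℝ) : ℂ) / Complex.Gamma (-(a / 2)))) := by
  obtain ⟨D', h, -, h0⟩ := parabolicD_and_derivs a
  rw [(h 0).deriv, h0]

theorem parabolicD_zero (a : ℂ) :
    parabolicD a 0 = (2 : ℂ) ^ (a / 2) * ((Real.sqrt Real.pi : ℝ) : ℂ) *
      (1 / Complex.Gamma ((1 - a) / 2)) := by
  simp [parabolicD, hyp1F1_zero]

theorem two_cpow_half_add (a : ℂ) :
    (2 : ℂ) ^ ((a + 1) / 2) = (2 : ℂ) ^ (a / 2) * ((Real.sqrt 2 : ℝ) : ℂ) := by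
  rw [add_div, Complex.cpow_add _ _ two_ne_zero, Real.sqrt_eq_rpow,
    Complex.ofReal_cpow (by norm_num)]
  norm_num

/-- True also at `s = 0`, where both sides are `0` because `Complex.Gamma 0 = 0`. -/
theorem one_div_Gamma_eq (s : ℂ) :
    1 / Complex.Gamma s = s / Complex.Gamma (s + 1) := by
  rcases eq_or_ne s 0 with rfl | hs
  · simp [Complex.Gamma_zero]
  · rw [Complex.Gamma_add_one s hs, ← div_div, div_self hs]

/-- The difference of the two sides solves Weber's equation with parameter `a + 1`. It vanishes at
`0`, and so does its derivative by the functional equation of `Γ`; uniqueness does the rest. -/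
theorem deriv_parabolicD (a ζ : ℂ) :
    deriv (parabolicD a) ζ = ζ / 2 * parabolicD a ζ - parabolicD (a + 1) ζ := by
  have hd : ∀ ζ, HasDerivAt
      (fun ζ => ζ / 2 * parabolicD a ζ - parabolicD (a + 1) ζ - deriv (parabolicD a) ζ)
      (1 / 2 * parabolicD a ζ + ζ / 2 * deriv (parabolicD a) ζ - deriv (parabolicD (a + 1)) ζ -
        (ζ ^ 2 / 4 - 1 / 2 - a) * parabolicD a ζ) ζ := fun ζ =>
    ((((hasDerivAt_id ζ).div_const 2).mul (hasDerivAt_parabolicD a ζ)).sub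
      (hasDerivAt_parabolicD (a + 1) ζ)).sub (hasDerivAt_deriv_parabolicD a ζ)
  have hdd : ∀ ζ, HasDerivAt
      (fun ζ => 1 / 2 * parabolicD a ζ + ζ / 2 * deriv (parabolicD a) ζ -
        deriv (parabolicD (a + 1)) ζ - (ζ ^ 2 / 4 - 1 / 2 - a) * parabolicD a ζ)
      ((ζ ^ 2 / 4 - 1 / 2 - (a + 1)) *
        (ζ / 2 * parabolicD a ζ - parabolicD (a + 1) ζ - deriv (parabolicD a) ζ)) ζ := fun ζ => by
    have hi := hasDerivAt_id ζ
    refine (((((hasDerivAt_parabolicD a ζ).const_mul (1 / 2)).add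
      ((hi.div_const 2).mul (hasDerivAt_deriv_parabolicD a ζ))).sub
      (hasDerivAt_deriv_parabolicD (a + 1) ζ)).sub
      (((((hi.pow 2).div_const 4).sub_const (1 / 2)).sub_const a).mul
        (hasDerivAt_parabolicD a ζ))).congr_deriv ?_
    simp
    ring
  have h := eq_zero_of_deriv_deriv_eq (Q := fun ζ => ζ ^ 2 / 4 - 1 / 2 - (a + 1))
    (fun ζ => (hd ζ).differentiableAt) (by fun_prop)
    (fun ζ => by
      rw [show deriv (fun ζ => ζ / 2 * parabolicD a ζ - parabolicD (a + 1) ζ -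
        deriv (parabolicD a) ζ) = _ from funext fun ζ => (hd ζ).deriv]
      exact (hdd ζ).deriv)
    (by
      rw [deriv_parabolicD_zero, parabolicD_zero, parabolicD_zero, two_cpow_half_add,
        show (1 - (a + 1)) / 2 = -(a / 2) by ring]
      ring)
    (by
      rw [(hd 0).deriv, deriv_parabolicD_zero, parabolicD_zero, deriv_parabolicD_zero,
        two_cpow_half_add]
      have h2 : ((Real.sqrt 2 : ℝ) : ℂ) ^ 2 = 2 := by
        rw [← Complex.ofReal_pow, Real.sq_sqrt (by norm_num)]; norm_num
      have h3 := one_div_Gamma_eq (-((a + 1) / 2))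
      rw [show -((a + 1) / 2) + 1 = (1 - a) / 2 by ring] at h3
      linear_combination ((2 : ℂ) ^ (a / 2) * ((Real.sqrt Real.pi : ℝ) : ℂ)) *
        ((1 / Complex.Gamma (-((a + 1) / 2))) * h2 + 2 * h3)) ζ
  linear_combination -h

/-- Both functions solve the same Weber equation since `k² = -1`, so the Wronskian is constant. At
`0` the reflection formula turns it into a nonzero multiple of `sin(πa/2) + k cos(πa/2)`. -/
theorem wronskian_parabolicD_ne_zero (a : ℂ) {k : ℂ} (hk : k ^ 2 = -1) (ζ : ℂ) :
    deriv (parabolicD a) ζ * parabolicD (-(a + 1)) (k * ζ) -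
      parabolicD a ζ * (k * deriv (parabolicD (-(a + 1))) (k * ζ)) ≠ 0 := by
  have hd : ∀ ζ, HasDerivAt (fun ζ => deriv (parabolicD a) ζ * parabolicD (-(a + 1)) (k * ζ) -
      parabolicD a ζ * (k * deriv (parabolicD (-(a + 1))) (k * ζ))) 0 ζ := fun ζ => by
    have hi : HasDerivAt (fun ζ => k * ζ) k ζ := by simpa using (hasDerivAt_id ζ).const_mul k
    refine (((hasDerivAt_deriv_parabolicD a ζ).mul
      ((hasDerivAt_parabolicD (-(a + 1)) (k * ζ)).comp ζ hi)).sub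
      ((hasDerivAt_parabolicD a ζ).mul
      (((hasDerivAt_deriv_parabolicD (-(a + 1)) (k * ζ)).comp ζ hi).const_mul k))).congr_deriv ?_
    simp only [Function.comp]
    linear_combination (-parabolicD a ζ * parabolicD (-(a + 1)) (k * ζ) *
      (ζ ^ 2 / 4 * (k ^ 2 - 1) + (a + 1 / 2))) * hk
  have hc := is_const_of_deriv_eq_zero (fun ζ => (hd ζ).differentiableAt)
    (fun ζ => (hd ζ).deriv) ζ 0
  rw [hc, mul_zero, deriv_parabolicD_zero, parabolicD_zero, parabolicD_zero,
    deriv_parabolicD_zero]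
  have h1 := Complex.Gamma_mul_Gamma_one_sub (-(a / 2))
  have h2 := Complex.Gamma_mul_Gamma_one_sub ((1 - a) / 2)
  rw [show (Real.pi : ℂ) * -(a / 2) = -(Real.pi * a / 2) by ring, Complex.sin_neg] at h1
  rw [show (Real.pi : ℂ) * ((1 - a) / 2) = Real.pi / 2 - Real.pi * a / 2 by ring,
    Complex.sin_pi_div_two_sub] at h2
  rw [show (1 - -(a + 1)) / 2 = 1 - -(a / 2) by ring,
    show -(-(a + 1) / 2) = 1 - (1 - a) / 2 by ring]
  have hpi : (Real.pi : ℂ) ≠ 0 := by exact_mod_cast Real.pi_ne_zero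
  have hspi : ((Real.sqrt Real.pi : ℝ) : ℂ) ≠ 0 := by
    exact_mod_cast (Real.sqrt_pos.mpr Real.pi_pos).ne'
  have hs2 : ((Real.sqrt 2 : ℝ) : ℂ) ≠ 0 := by
    exact_mod_cast (Real.sqrt_pos.mpr two_pos).ne'
  -- Inverted, the reflection formula stays valid at the poles, where both sides are `0`.
  have h1' := congrArg (·⁻¹) h1
  have h2' := congrArg (·⁻¹) h2
  simp only [mul_inv, inv_div] at h1' h2'
  have h2c : ∀ s : ℂ, (2 : ℂ) ^ s ≠ 0 := fun s => by simp [Complex.cpow_eq_zero_iff]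
  -- A zero would give `sin² = -cos²`, contradicting `sin² + cos² = 1`.
  have key : Complex.sin (Real.pi * a / 2) + k * Complex.cos (Real.pi * a / 2) ≠ 0 := by
    intro h
    have := Complex.sin_sq_add_cos_sq (Real.pi * a / 2)
    rw [eq_neg_of_add_eq_zero_left h, neg_sq, mul_pow, hk] at this
    simp at this
  have hne : (2 : ℂ) ^ (a / 2) * (2 : ℂ) ^ (-(a + 1) / 2) * ((Real.sqrt Real.pi : ℝ) : ℂ) ^ 2 *
      ((Real.sqrt 2 : ℝ) : ℂ) *
      ((Complex.sin (Real.pi * a / 2) + k * Complex.cos (Real.pi * a / 2)) / Real.pi) ≠ 0 := by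
    simp [h2c, hspi, hs2, hpi, key]
  convert hne using 1
  linear_combination (2 : ℂ) ^ (a / 2) * (2 : ℂ) ^ (-(a + 1) / 2) *
    ((Real.sqrt Real.pi : ℝ) : ℂ) ^ 2 * ((Real.sqrt 2 : ℝ) : ℂ) * (k * h2' - h1')

end Parabolic

/-! ### Monomials and evaluation of Laurent polynomials. -/

namespace LaurentPoly

variable {V : Type}

theorem mono_mul_mono (e f : V → ℚ) : mono e * mono f = mono (e + f) := by
  simp [mono, AddMonoidAlgebra.single_mul_single]

theorem pow_mul_pow [DecidableEq V] (i : V) (a b : ℚ) :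
    pow i a * pow i b = pow i (a + b) := by
  rw [pow, pow, pow, mono_mul_mono, Pi.single_add]

theorem pow_mul_pow_neg [DecidableEq V] (i : V) (a : ℚ) : pow i a * pow i (-a) = 1 := by
  rw [pow_mul_pow, add_neg_cancel, pow, Pi.single_zero, mono, AddMonoidAlgebra.one_def]

theorem eval_single [Fintype V] (P : V → ℂ) (e : V → ℚ) (c : ℂ) :
    eval P (AddMonoidAlgebra.single e c) = c * ∏ i, P i ^ (e i : ℂ) := by
  rw [eval, AddMonoidAlgebra.coeff_single, Finsupp.sum_single_index (zero_mul _)]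

theorem eval_add [Fintype V] (P : V → ℂ) (f g : LaurentPoly V) :
    eval P (f + g) = eval P f + eval P g := by
  rw [eval, eval, eval, AddMonoidAlgebra.coeff_add]
  exact Finsupp.sum_add_index' (fun _ => zero_mul _) fun _ _ _ => add_mul _ _ _

theorem eval_smul [Fintype V] (P : V → ℂ) (c : ℂ) (f : LaurentPoly V) :
    eval P (c • f) = c * eval P f := by
  rw [eval, eval, AddMonoidAlgebra.coeff_smul, Finsupp.sum_smul_index' fun _ => zero_mul _,
    Finsupp.mul_sum]
  simp only [smul_eq_mul, mul_assoc]

end LaurentPoly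

theorem Grammar.formalDeriv_pow {V : Type} [Fintype V] [DecidableEq V] (G : Grammar V) (i : V)
    (a : ℚ) : formalDeriv G (.pow i a) = (a : ℂ) • (LaurentPoly.pow i (a - 1) * G i) := by
  have h : formalDeriv G (.pow i a) = (1 : ℂ) • derivMono G (Pi.single i a) :=
    derivLin_single G _ 1
  rw [h, one_smul, derivMono, Finset.sum_eq_single i]
  · rw [Pi.single_eq_same, ← Pi.single_sub, LaurentPoly.pow]
  · intro j _ hj
    simp [hj]
  · simp

/-! ### Reduction of the grammar to polynomials in `y, w, zu, xv`. -/

section Peak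

open LaurentPoly Grammar MvPolynomial

/-- The polynomials in `y`, `w`, `zu` and `xv`, as Laurent polynomials. -/
noncomputable def peakHom : MvPolynomial (Fin 4) ℂ →ₐ[ℂ] LaurentPoly PeakVar :=
  aeval ![.pow .y 1, .pow .w 1, .pow .z 1 * .pow .u 1, .pow .x 1 * .pow .v 1]

/-- The derivation induced by the peak grammar on polynomials in `y`, `w`, `zu` and `xv`. -/
noncomputable def peakDer :
    Derivation ℂ (MvPolynomial (Fin 4) ℂ) (MvPolynomial (Fin 4) ℂ) :=
  mkDerivation ℂ ![X 2, X 3, X 1 * X 2 + X 0 * X 3, X 1 * X 2 + X 0 * X 3]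

/-- The operator on polynomials in `y`, `w`, `zu`, `xv` that corresponds to the formal derivative
of multiples of `x^(-1/2) z^(-1/2)`. -/
noncomputable def peakOp (P : MvPolynomial (Fin 4) ℂ) : MvPolynomial (Fin 4) ℂ :=
  peakDer P - C (1 / 2) * (X 0 + X 1) * P

/-- The negative powers in the rules for `u` and `v` cancel in `zu` and `xv`, so these polynomials
are closed under the derivative. -/
theorem formalDeriv_peakHom_X (i : Fin 4) :
    formalDeriv peakGrammar (peakHom (X i)) = peakHom (peakDer (X i)) := by
  have hx := pow_mul_pow_neg PeakVar.x 1
  have hz := pow_mul_pow_neg PeakVar.z 1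
  fin_cases i <;>
    simp [peakHom, peakDer, formalDeriv_var, mkDerivation_X, peakGrammar, Derivation.leibniz]
  · linear_combination (pow PeakVar.x 1 * pow PeakVar.y 1 * pow PeakVar.v 1) * hz
  · linear_combination (pow PeakVar.z 1 * pow PeakVar.w 1 * pow PeakVar.u 1) * hx

theorem formalDeriv_peakHom (P : MvPolynomial (Fin 4) ℂ) :
    formalDeriv peakGrammar (peakHom P) = peakHom (peakDer P) := by
  induction P using MvPolynomial.induction_on with
  | C a =>
    rw [← MvPolynomial.algebraMap_eq, AlgHom.commutes, Derivation.map_algebraMap,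
      Derivation.map_algebraMap, map_zero]
  | add p q hp hq => simp [hp, hq]
  | mul_X p i hp =>
    simp only [map_mul, Derivation.leibniz, hp, formalDeriv_peakHom_X, smul_eq_mul, map_add]

theorem formalDeriv_peakBase :
    formalDeriv peakGrammar (pow .x (-1 / 2) * pow .z (-1 / 2)) =
      -peakHom (C (1 / 2) * (X 0 + X 1)) * (pow .x (-1 / 2) * pow .z (-1 / 2)) := by
  have h : ∀ i : PeakVar, pow i (-1 / 2 - 1) * pow i 1 = pow i (-1 / 2) := fun i => by
    rw [pow_mul_pow]; norm_num
  have hC : peakHom (C (1 / 2)) = (1 / 2 : ℂ) • (1 : LaurentPoly PeakVar) := by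
    rw [← MvPolynomial.algebraMap_eq, AlgHom.commutes, Algebra.algebraMap_eq_smul_one]
  have hy : peakHom (X 0) = pow .y 1 := by simp [peakHom]
  have hw : peakHom (X 1) = pow .w 1 := by simp [peakHom]
  have hc : (((-1 / 2 : ℚ)) : ℂ) = -(1 / 2) := by push_cast; ring
  rw [Derivation.leibniz, formalDeriv_pow, formalDeriv_pow, map_mul, map_add, hC, hy, hw, hc]
  simp only [peakGrammar, smul_eq_mul, smul_mul_assoc, mul_smul_comm, one_mul, neg_smul, neg_mul,
    mul_neg]
  rw [← mul_assoc (pow PeakVar.z _), ← mul_assoc (pow PeakVar.x (_ - 1)), h, h, ← neg_add,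
    ← smul_add]
  congr 2
  ring

theorem iterate_formalDeriv_peakBase (n : ℕ) :
    (formalDeriv peakGrammar)^[n] (pow .x (-1 / 2) * pow .z (-1 / 2)) =
      peakHom (peakOp^[n] 1) * (pow .x (-1 / 2) * pow .z (-1 / 2)) := by
  induction n with
  | zero => simp
  | succ n ih =>
    rw [Function.iterate_succ_apply', Function.iterate_succ_apply', ih, Derivation.leibniz,
      formalDeriv_peakHom, formalDeriv_peakBase, peakOp, map_sub]
    simp only [smul_eq_mul, map_mul]
    ring

theorem prod_peakVar (f : PeakVar → ℂ) :
    ∏ i, f i = f .x * f .y * f .z * f .w * f .u * f .v := by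
  have h : (Finset.univ : Finset PeakVar) = {.x, .y, .z, .w, .u, .v} := rfl
  rw [h]
  simp [mul_assoc]

/-- Only `x` and `z` carry fractional exponents; being nonzero, their powers split additively. The
other variables occur to natural powers, so they may vanish. -/
theorem eval_peakHom_mul_base (x y z w u v : ℂ) (hx : x ≠ 0) (hz : z ≠ 0)
    (P : MvPolynomial (Fin 4) ℂ) :
    LaurentPoly.eval (peakPoint x y z w u v)
        (peakHom P * (.pow .x (-1 / 2) * .pow .z (-1 / 2))) =
      MvPolynomial.eval ![y, w, z * u, x * v] P * (x ^ (-1 / 2 : ℂ) * z ^ (-1 / 2 : ℂ)) := by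
  induction P using MvPolynomial.induction_on' with
  | add p q hp hq => rw [map_add, add_mul, LaurentPoly.eval_add, hp, hq, map_add, add_mul]
  | monomial s c =>
    have h : peakHom (monomial s c) * (.pow .x (-1 / 2) * .pow .z (-1 / 2)) =
        AddMonoidAlgebra.single (fun i : PeakVar => match i with
          | .x => (s 3 : ℚ) + (-1 / 2)
          | .y => s 0
          | .z => (s 2 : ℚ) + (-1 / 2)
          | .w => s 1
          | .u => s 2
          | .v => s 3) c := by
      rw [peakHom, aeval_monomial, Finsupp.prod_fintype _ _ (by simp), Fin.prod_univ_four]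
      simp only [Matrix.cons_val, LaurentPoly.pow, LaurentPoly.mono,
        AddMonoidAlgebra.single_mul_single, AddMonoidAlgebra.single_pow, one_pow, mul_one,
        Algebra.algebraMap_eq_smul_one, smul_mul_assoc, one_mul]
      rw [AddMonoidAlgebra.smul_single, smul_eq_mul, mul_one]
      congr 1
      funext i
      cases i <;> simp
    rw [h, LaurentPoly.eval_single, prod_peakVar, MvPolynomial.eval_monomial,
      Finsupp.prod_fintype _ _ (by simp), Fin.prod_univ_four]
    simp only [Matrix.cons_val, peakPoint, Rat.cast_natCast, Complex.cpow_natCast]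
    push_cast
    rw [Complex.cpow_add _ _ hx, Complex.cpow_add _ _ hz, Complex.cpow_natCast,
      Complex.cpow_natCast]
    ring

end Peak

/-! ### From the second-order equation back to the flow. -/

section Flow

open MvPolynomial Filter Topology

theorem hasDerivAt_eval_peakDer {g : ℂ → Fin 4 → ℂ} {t : ℂ}
    (hg : ∀ i, HasDerivAt (fun t => g t i) (eval (g t) (peakDer (X i))) t)
    (P : MvPolynomial (Fin 4) ℂ) :
    HasDerivAt (fun t => eval (g t) P) (eval (g t) (peakDer P)) t := by
  induction P using MvPolynomial.induction_on with
  | C a => simpa using hasDerivAt_const t a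
  | add p q hp hq =>
    simp only [map_add]
    exact hp.add hq
  | mul_X p i hp =>
    simp only [map_mul, eval_X, Derivation.leibniz, smul_eq_mul, map_add]
    exact (hp.mul (hg i)).congr_deriv (by ring)

/-- The iterated derivatives of a solution of the equation satisfied by
`Gen(x^(-1/2) z^(-1/2), t)` are given by iterates of `peakOp`. -/
theorem iteratedDeriv_eq_eval_peakOp {H H1 : ℂ → ℂ} {y w U V : ℂ}
    (hH : ∀ t, HasDerivAt H (H1 t) t)
    (hH1 : ∀ t, HasDerivAt H1
      (((w - y + (V - U) * t) ^ 2 / 4 - (U - y * w) - (V - U) / 2) * H t) t)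
    (h0 : H 0 ≠ 0) (h1 : H1 0 = -((y + w) / 2) * H 0) (n : ℕ) :
    iteratedDeriv n H 0 = eval ![y, w, U, V] (peakOp^[n] 1) * H 0 := by
  -- Solves `Y + W = -2 H'/H` and `W - Y = w - y + (V - U) t`; the last two coordinates of `g` come
  -- from the conserved quantities.
  set Y : ℂ → ℂ := fun t => -(H1 t / H t) - (w - y + (V - U) * t) / 2 with hY
  set W : ℂ → ℂ := fun t => -(H1 t / H t) + (w - y + (V - U) * t) / 2 with hW
  set g : ℂ → Fin 4 → ℂ := fun t =>
    ![Y t, W t, Y t * W t + (U - y * w), Y t * W t + (U - y * w) + (V - U)] with hg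
  have hne : ∀ᶠ t in 𝓝 (0 : ℂ), H t ≠ 0 := (hH 0).continuousAt.eventually_ne h0
  have hder : ∀ t, H t ≠ 0 →
      ∀ i, HasDerivAt (fun t => g t i) (eval (g t) (peakDer (X i))) t := by
    intro t ht
    have hq := ((hH1 t).div (hH t) ht).neg
    have hl : HasDerivAt (fun t => (w - y + (V - U) * t) / 2) ((V - U) / 2) t := by
      simpa using (((hasDerivAt_id t).const_mul (V - U)).const_add (w - y)).div_const 2
    have hYd : HasDerivAt Y (Y t * W t + (U - y * w)) t :=
      (hq.sub hl).congr_deriv (by simp only [hY, hW]; field_simp; ring)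
    have hWd : HasDerivAt W (Y t * W t + (U - y * w) + (V - U)) t :=
      (hq.add hl).congr_deriv (by simp only [hY, hW]; field_simp; ring)
    have hUd := (hYd.mul hWd).add_const (U - y * w)
    intro i
    fin_cases i
    · simpa [hg, peakDer, mkDerivation_X] using hYd
    · simpa [hg, peakDer, mkDerivation_X] using hWd
    · refine hUd.congr_deriv ?_
      simp [hg, peakDer, mkDerivation_X]
      ring
    · refine (hUd.add_const (V - U)).congr_deriv ?_
      simp [hg, peakDer, mkDerivation_X]
      ring
  -- Stated near `0`, not only at `0`, so that the induction can differentiate it.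
  have key : ∀ n : ℕ, ∀ᶠ t in 𝓝 (0 : ℂ),
      iteratedDeriv n H t = eval (g t) (peakOp^[n] 1) * H t := by
    intro n
    induction n with
    | zero => simp
    | succ n ih =>
      filter_upwards [ih.eventually_nhds, hne] with t ht hHt
      rw [iteratedDeriv_succ, EventuallyEq.deriv_eq ht, Function.iterate_succ_apply', peakOp]
      refine ((hasDerivAt_eval_peakDer (hder t hHt) _).mul (hH t)).deriv.trans ?_
      simp only [map_sub, map_mul, map_add, eval_C, eval_X]
      simp only [hg, hY, hW, Matrix.cons_val]
      field_simp
      ring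
  have hg0 : g 0 = ![y, w, U, V] := by
    have hr : H1 0 / H 0 = -((y + w) / 2) := by rw [h1, mul_div_assoc, div_self h0, mul_one]
    have hY0 : Y 0 = y := by simp only [hY, hr]; ring
    have hW0 : W 0 = w := by simp only [hW, hr]; ring
    simp only [hg, hY0, hW0]
    congr 3 <;> ring_nf
  rw [(key n).self_of_nhds, hg0]

end Flow

/-! ### Matching the initial data. -/

theorem mainTheorem10 (x y z w u v : ℂ) (hx : x ≠ 0) (hz : z ≠ 0) (hne : x * v - z * u ≠ 0)
    (δ δ' : ℂ) (hδ : δ ^ 2 = x * v - z * u) (hδ' : δ' ^ 2 = z * u - x * v)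
    (p q r s : ℂ)
    (hp : p = parabolicD ((z * u - y * w) / δ ^ 2) ((w - y) / δ))
    (hq : q = parabolicD ((x * v - y * w) / δ' ^ 2) ((y - w) / δ'))
    (hr : r = parabolicD ((x * v - y * w) / δ ^ 2) ((w - y) / δ))
    (hs : s = parabolicD ((z * u - y * w) / δ' ^ 2) ((y - w) / δ')) :
    p * q * (w - y) + (δ' * p * s - δ * q * r) ≠ 0 ∧
    ∀ t : ℂ, HasSum
      (fun n : ℕ => LaurentPoly.eval (peakPoint x y z w u v)
        (PowerSeries.coeff n
          (peakGrammar.gen (LaurentPoly.pow .x (-1 / 2) * LaurentPoly.pow .z (-1 / 2)))) * t ^ n)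
      (x ^ (-1 / 2 : ℂ) * z ^ (-1 / 2 : ℂ) /
          (p * q * (w - y) + (δ' * p * s - δ * q * r)) *
        ((δ' * s - q * y) * parabolicD ((z * u - y * w) / δ ^ 2) (δ * t + (w - y) / δ) +
          (p * w - δ * r) *
            parabolicD ((x * v - y * w) / δ' ^ 2) (δ' * t + (y - w) / δ'))) := by
  have hδ0 : δ ≠ 0 := by
    rintro rfl
    exact hne (by rw [← hδ]; ring)
  have hδ'0 : δ' ≠ 0 := by
    rintro rfl
    exact hne (by linear_combination hδ')
  set a : ℂ := (z * u - y * w) / δ ^ 2 with ha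
  set ζ : ℂ := (w - y) / δ with hζ
  set k : ℂ := δ' / δ with hk
  have hkδ : k * δ = δ' := div_mul_cancel₀ _ hδ0
  have hζδ : ζ * δ = w - y := div_mul_cancel₀ _ hδ0
  have haδ : a * δ ^ 2 = z * u - y * w := div_mul_cancel₀ _ (pow_ne_zero 2 hδ0)
  have hk2 : k ^ 2 = -1 := by
    rw [hk, div_pow, div_eq_iff (pow_ne_zero 2 hδ0)]
    linear_combination hδ' + hδ
  -- All four orders become `a`, `a + 1`, `-(a + 1)`, `-(a + 1) + 1`, the pairs linked by the
  -- recurrence.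
  have e1 : (x * v - y * w) / δ ^ 2 = a + 1 := by
    rw [div_eq_iff (pow_ne_zero 2 hδ0)]
    linear_combination -haδ - hδ
  have e2 : (x * v - y * w) / δ' ^ 2 = -(a + 1) := by
    rw [div_eq_iff (pow_ne_zero 2 hδ'0)]
    linear_combination (a + 1) * (hδ' + hδ) - haδ - hδ
  have e3 : (z * u - y * w) / δ' ^ 2 = -(a + 1) + 1 := by
    rw [div_eq_iff (pow_ne_zero 2 hδ'0)]
    linear_combination a * (hδ' + hδ) - haδ
  have e4 : (y - w) / δ' = k * ζ := by
    rw [div_eq_iff hδ'0, ← hkδ]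
    linear_combination hζδ - ζ * δ * hk2
  rw [e2, e4] at hq
  rw [e1] at hr
  rw [e3, e4] at hs
  rw [e2, e4]
  have dp : deriv (parabolicD a) ζ = ζ / 2 * p - r := by rw [deriv_parabolicD, ← hp, ← hr]
  have dq : deriv (parabolicD (-(a + 1))) (k * ζ) = k * ζ / 2 * q - s := by
    rw [deriv_parabolicD, ← hq, ← hs]
  have hN : p * q * (w - y) + (δ' * p * s - δ * q * r) ≠ 0 := by
    -- `δ` times the Wronskian at `ζ` is the denominator.
    have hW := mul_ne_zero hδ0 (wronskian_parabolicD_ne_zero a hk2 ζ)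
    rw [dp, dq, ← hp, ← hq] at hW
    convert hW using 1
    rw [← hkδ, ← hζδ]
    linear_combination (p * q * ζ * δ / 2) * hk2
  refine ⟨hN, fun t => ?_⟩
  have hf0 : x ^ (-1 / 2 : ℂ) * z ^ (-1 / 2 : ℂ) ≠ 0 :=
    mul_ne_zero (by simp [Complex.cpow_eq_zero_iff, hx]) (by simp [Complex.cpow_eq_zero_iff, hz])
  set f0 : ℂ := x ^ (-1 / 2 : ℂ) * z ^ (-1 / 2 : ℂ) with hf0'
  set N : ℂ := p * q * (w - y) + (δ' * p * s - δ * q * r) with hNdef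
  set H : ℂ → ℂ := fun t => f0 / N * ((δ' * s - q * y) * parabolicD a (δ * t + ζ) +
    (p * w - δ * r) * parabolicD (-(a + 1)) (δ' * t + k * ζ)) with hH
  set H1 : ℂ → ℂ := fun t => f0 / N *
    ((δ' * s - q * y) * (deriv (parabolicD a) (δ * t + ζ) * δ) +
    (p * w - δ * r) * (deriv (parabolicD (-(a + 1))) (δ' * t + k * ζ) * δ')) with hH1
  have hlin : ∀ m c t : ℂ, HasDerivAt (fun t => m * t + c) m t := fun m c t => by
    simpa using ((hasDerivAt_id t).const_mul m).add_const c
  have hHd : ∀ t, HasDerivAt H (H1 t) t := fun t =>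
    ((((hasDerivAt_parabolicD a _).comp t (hlin δ ζ t)).const_mul _).add
      (((hasDerivAt_parabolicD (-(a + 1)) _).comp t (hlin δ' (k * ζ) t)).const_mul _)).const_mul _
  have hH1d : ∀ t, HasDerivAt H1 (((w - y + (x * v - z * u) * t) ^ 2 / 4 -
      (z * u - y * w) - (x * v - z * u) / 2) * H t) t := fun t => by
    refine ((((((hasDerivAt_deriv_parabolicD a _).comp t (hlin δ ζ t)).mul_const δ).const_mul
      _).add ((((hasDerivAt_deriv_parabolicD (-(a + 1)) _).comp t
      (hlin δ' (k * ζ) t)).mul_const δ').const_mul _)).const_mul _).congr_deriv ?_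
    simp only [hH]
    rw [← hδ, ← hζδ, ← haδ, ← hkδ]
    linear_combination (f0 / N * ((p * w - δ * r) *
      parabolicD (-(a + 1)) (k * δ * t + k * ζ)) * δ ^ 2 *
      ((δ * t + ζ) ^ 2 / 4 * (k ^ 2 - 1) + (a + 1 / 2))) * hk2
  have hH0 : H 0 = f0 := by
    simp only [hH, mul_zero, zero_add]
    rw [← hp, ← hq, div_mul_eq_mul_div, div_eq_iff hN, hNdef]
    ring
  have hH10 : H1 0 = -((y + w) / 2) * H 0 := by
    rw [hH0]
    simp only [hH1, mul_zero, zero_add]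
    rw [dp, dq, div_mul_eq_mul_div, div_eq_iff hN, hNdef, ← hkδ]
    linear_combination (f0 / 2 * ((k * δ * s - q * y) * p - (p * w - δ * r) * q)) * hζδ +
      (f0 * (p * w - δ * r) * ζ * δ * q / 2) * hk2
  have hT := Complex.hasSum_taylorSeries_of_entire
    (fun t => (hHd t).differentiableAt : Differentiable ℂ H) 0 t
  refine hT.congr_fun fun n => ?_
  rw [iteratedDeriv_eq_eval_peakOp hHd hH1d (by rwa [hH0]) hH10, hH0, Grammar.gen,
    PowerSeries.coeff_mk, iterate_formalDeriv_peakBase, LaurentPoly.eval_smul,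
    eval_peakHom_mul_base x y z w u v hx hz, sub_zero, smul_eq_mul, smul_eq_mul]
  ring
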